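/- Let $K$ be a number field with ring of integers $O_K$, and fix an embedding $\sigma_0:K\to\mathbb C$. A hermitian $O_K$-module is a finitely generated projective $O_K$-module $E$ together with a positive definite hermitian form on $E_\sigma=\mathbb C\otimes_\sigma E$ for every embedding $\sigma:K\to\mathbb C$; write $\|\cdot\|_\sigma$ for the corresponding norm. Duals, tensor products and tensor powers carry the induced metrics. Fix a hermitian $O_K$-module $H$ of rank one, and for a hermitian $O_K$-module $F$ and an integer $x\ge 0$ put $F(x)=F\otimes H^{\otimes x}$. Let $E$ be a hermitian $O_K$-module of rank $m$, let $f\in E_{\sigma_0}$ be a non-zero vector, and let $r_1$ be the dimension of the smallest $K$-subspace $W\subseteq E_K=E\otimes_{O_K}K$ containing $f$, that is, with $f\in W\otimes_{K,\sigma_0}\mathbb C$. For $P\in E^\vee(x)$ denote by $\langle P,f\rangle\in (H^{\otimes x})_{\sigma_0}$ the contraction of $P$ with $f$. We put $\log 0=-\infty$. **Theorem.** Let $c_1,c_2,c_3$ be real constants with $c_2>0$. There are real constants $C_1>0$ and $C_2$, depending only on $c_1,c_2,c_3$ and the degree $[K:\mathbb Q]$ (in particular independent of $m$, $E$, $f$,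 $H$, $b_1$, $b_2$), such that the following holds. Suppose that for some real constants $b_1,b_2$ (which may depend on $m$, $E$, $f$ and $H$, but not on $x$) and for every sufficiently large integer $x$ there exist $O_K$-linearly independent $P_1,\dots,P_m\in E^\vee(x)$ such that, with $F_i=\langle P_i,f\rangle$, for all $i=1,\dots,m$: 1. $\displaystyle\sup_{\sigma:K\to\mathbb C}\log\|P_i\|_\sigma\le c_1\,x\log x+b_1x$; 2. $\displaystyle\log\|F_i\|_{\sigma_0}\le c_1\,x\log x-c_2\,m\,x\log x+c_3\,x\log x+b_2x$. Then $$r_1\ge C_1m+C_2 .$$ -/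

import Mathlib

open scoped TensorProduct ComplexConjugate NumberField

universe u v w

noncomputable section

namespace ArakelovCriterion

/-! ### Two ways of transporting a positive definite hermitian form -/

/-- The restriction of an inner product along an injective linear map. -/
@[reducible]
def coreComap {V W : Type*} [AddCommGroup V] [Module ℂ V]
    [NormedAddCommGroup W] [InnerProductSpace ℂ W] (g : V →ₗ[ℂ] W)
    (hg : Function.Injective g) : InnerProductSpace.Core ℂ V where
  inner a b := inner ℂ (g a) (g b)
  conj_inner_symm a b := inner_conj_symm _ _
  re_inner_nonneg a := inner_self_nonneg
  add_left a b c := by rw [map_add, inner_add_left]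
  smul_left a b r := by rw [map_smul, inner_smul_left]
  definite a h := by
    rw [inner_self_eq_zero] at h
    exact hg (by rw [h, map_zero])

/-- The inner product `⟪a, b⟫ := ⟪g b, g a⟫` obtained from an injective conjugate-linear map `g`. -/
@[reducible]
def coreComapConj {V W : Type*} [AddCommGroup V] [Module ℂ V]
    [NormedAddCommGroup W] [InnerProductSpace ℂ W] (g : V →ₗ⋆[ℂ] W)
    (hg : Function.Injective g) : InnerProductSpace.Core ℂ V where
  inner a b := inner ℂ (g b) (g a)
  conj_inner_symm a b := inner_conj_symm _ _
  re_inner_nonneg a := inner_self_nonneg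
  add_left a b c := by rw [map_add, inner_add_right]
  smul_left a b r := by rw [LinearMap.map_smulₛₗ, inner_smul_right]
  definite a h := by
    rw [inner_self_eq_zero] at h
    exact hg (by rw [h, map_zero])

/-! ### Complexification of an `𝓞 K`-module

First for a given `K`-algebra structure on `ℂ`, then for the one defined by an embedding `σ`. -/

section BaseChange

variable {K : Type u} [Field K] [Algebra K ℂ]
  (M : Type v) [AddCommGroup M] [Module (𝓞 K) M] (N : Type w) [AddCommGroup N] [Module (𝓞 K) N]

variable (K) in
/-- The complex vector space `ℂ ⊗ M`. -/
abbrev BaseChange : Type v := ℂ ⊗[𝓞 K] M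

@[reducible]
def baseChangeAddCommGroup : AddCommGroup (ℂ ⊗[𝓞 K] M) := inferInstance

@[reducible]
def baseChangeModule : Module ℂ (ℂ ⊗[𝓞 K] M) := inferInstance

theorem baseChange_finite [Module.Finite (𝓞 K) M] : Module.Finite ℂ (ℂ ⊗[𝓞 K] M) :=
  inferInstance

variable {M N} in
def baseChangeTmul (z : ℂ) (e : M) : ℂ ⊗[𝓞 K] M := z ⊗ₜ e

variable {M N} in
def baseChangeMap (g : M →ₗ[𝓞 K] N) : (ℂ ⊗[𝓞 K] M) →ₗ[ℂ] (ℂ ⊗[𝓞 K] N) := g.baseChange ℂ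

variable (K) in
/-- The canonical isomorphism `ℂ ⊗ 𝓞 K = ℂ`. -/
def baseChangeUnit : ℂ ⊗[𝓞 K] 𝓞 K ≃ₗ[ℂ] ℂ :=
  TensorProduct.AlgebraTensorModule.rid (𝓞 K) ℂ ℂ

/-- The canonical isomorphism `ℂ ⊗ (M ⊗ N) = (ℂ ⊗ M) ⊗ (ℂ ⊗ N)`. -/
def baseChangeTensor : ℂ ⊗[𝓞 K] (M ⊗[𝓞 K] N) ≃ₗ[ℂ] (ℂ ⊗[𝓞 K] M) ⊗[ℂ] (ℂ ⊗[𝓞 K] N) :=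
  TensorProduct.AlgebraTensorModule.distribBaseChange (𝓞 K) ℂ M N

/-- The canonical map `ℂ ⊗ M^∨ → (ℂ ⊗ M)^∨`, where `M^∨ = Hom(M, 𝓞 K)`. -/
def baseChangeDual :
    ℂ ⊗[𝓞 K] Module.Dual (𝓞 K) M →ₗ[ℂ] Module.Dual ℂ (ℂ ⊗[𝓞 K] M) :=
  LinearMap.liftBaseChange ℂ (Module.Dual.baseChange ℂ)

theorem baseChangeDual_tmul (z a : ℂ) (φ : Module.Dual (𝓞 K) M) (e : M) :
    baseChangeDual M (z ⊗ₜ φ) (a ⊗ₜ e) = z * (a * algebraMap (𝓞 K) ℂ (φ e)) := by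
  simp [baseChangeDual, Algebra.smul_def, mul_comm]

theorem baseChangeDual_injective [Module.Finite (𝓞 K) M] [Module.Projective (𝓞 K) M] :
    Function.Injective (baseChangeDual (K := K) M) := by
  have h : ∀ (t : ℂ ⊗[𝓞 K] Module.Dual (𝓞 K) M) (e : M),
      baseChangeDual M t (1 ⊗ₜ e) =
        dualTensorHom (𝓞 K) M ℂ (TensorProduct.comm (𝓞 K) _ _ t) e := by
    intro t e
    induction t with
    | zero => simp
    | add a b ha hb => simp only [map_add, LinearMap.add_apply, ha, hb]
    | tmul z φ => simp [baseChangeDual_tmul, Algebra.smul_def, mul_comm]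
  intro a b hab
  apply (TensorProduct.comm (𝓞 K) ℂ (Module.Dual (𝓞 K) M)).injective
  apply (dualTensorHom_bijective).injective
  ext e
  rw [← h, ← h, hab]

/-- The canonical map `K ⊗ M → ℂ ⊗ M`. -/
def baseChangeGeneric : K ⊗[𝓞 K] M →ₗ[K] ℂ ⊗[𝓞 K] M :=
  TensorProduct.AlgebraTensorModule.map (Algebra.linearMap K ℂ) LinearMap.id

/-- The coordinate `ℂ ⊗ M → K ⊗ M` attached to a `K`-linear form on `ℂ`. -/
def baseChangeCoord (l : ℂ →ₗ[K] K) : ℂ ⊗[𝓞 K] M →ₗ[K] K ⊗[𝓞 K] M :=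
  TensorProduct.AlgebraTensorModule.map l LinearMap.id

theorem baseChangeCoord_smul_generic (l : ℂ →ₗ[K] K) (z : ℂ) (t : K ⊗[𝓞 K] M) :
    baseChangeCoord M l (z • baseChangeGeneric M t) = l z • t := by
  induction t with
  | zero => simp
  | add a b ha hb => rw [map_add, smul_add, map_add, ha, hb, smul_add]
  | tmul k e =>
    have h : z * algebraMap K ℂ k = k • z := by rw [Algebra.smul_def, mul_comm]
    simp [baseChangeGeneric, baseChangeCoord, TensorProduct.smul_tmul', h, mul_comm]

theorem exists_eq_sum_coord {ι : Type*} (b : Module.Basis ι K ℂ) (f : ℂ ⊗[𝓞 K] M) :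
    ∃ s : Finset ι, ∀ t, s ⊆ t →
      f = ∑ i ∈ t, b i • baseChangeGeneric M (baseChangeCoord M (b.coord i) f) := by
  classical
  induction f with
  | zero => exact ⟨∅, fun t _ => by simp⟩
  | add x y hx hy =>
    obtain ⟨s₁, h₁⟩ := hx
    obtain ⟨s₂, h₂⟩ := hy
    refine ⟨s₁ ∪ s₂, fun t ht => ?_⟩
    have e₁ := h₁ t (Finset.union_subset_left ht)
    have e₂ := h₂ t (Finset.union_subset_right ht)
    simp only [map_add, smul_add, Finset.sum_add_distrib]
    rw [← e₁, ← e₂]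
  | tmul z e =>
    refine ⟨(b.repr z).support, fun t ht => ?_⟩
    have hz : z = ∑ i ∈ t, b i * algebraMap K ℂ (b.coord i z) := by
      conv_lhs => rw [← b.linearCombination_repr z]
      rw [Finsupp.linearCombination_apply, Finsupp.sum_of_support_subset _ ht]
      · simp [Algebra.smul_def, mul_comm]
      · simp
    conv_lhs => rw [hz, TensorProduct.sum_tmul]
    simp [baseChangeGeneric, baseChangeCoord, TensorProduct.smul_tmul']

theorem mem_span_generic_iff {ι : Type*} (b : Module.Basis ι K ℂ) (W : Submodule K (K ⊗[𝓞 K] M))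
    (f : ℂ ⊗[𝓞 K] M) :
    f ∈ Submodule.span ℂ (baseChangeGeneric M '' (W : Set (K ⊗[𝓞 K] M))) ↔
      ∀ i, baseChangeCoord M (b.coord i) f ∈ W := by
  constructor
  · intro hf i
    obtain ⟨n, c, g, rfl⟩ := (Submodule.mem_span_set' (R := ℂ)).1 hf
    rw [map_sum]
    refine Submodule.sum_mem _ fun j _ => ?_
    obtain ⟨w, hw, hwj⟩ := (g j).2
    rw [← hwj, baseChangeCoord_smul_generic]
    exact W.smul_mem _ hw
  · intro h
    obtain ⟨s, hs⟩ := exists_eq_sum_coord M b f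
    rw [hs s subset_rfl]
    exact Submodule.sum_mem _ fun i _ =>
      Submodule.smul_mem _ _ (Submodule.subset_span ⟨_, h i, rfl⟩)

theorem isLeast_sInf_generic (f : ℂ ⊗[𝓞 K] M) :
    IsLeast {W : Submodule K (K ⊗[𝓞 K] M) |
        f ∈ Submodule.span ℂ (baseChangeGeneric M '' (W : Set (K ⊗[𝓞 K] M)))}
      (sInf {W : Submodule K (K ⊗[𝓞 K] M) |
        f ∈ Submodule.span ℂ (baseChangeGeneric M '' (W : Set (K ⊗[𝓞 K] M)))}) := by
  refine ⟨?_, fun W hW => sInf_le hW⟩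
  have b := Module.Basis.ofVectorSpace K ℂ
  simp only [Set.mem_ofPred_eq, mem_span_generic_iff M b, Submodule.mem_sInf]
  exact fun i W hW => hW i

end BaseChange

section Fiber

variable {K : Type u} [Field K]

/-- `ℂ` as a `K`-algebra through `σ`; it is an `𝓞 K`-algebra by restriction. -/
@[reducible]
def algebraVia (σ : K →+* ℂ) : Algebra K ℂ := σ.toAlgebra

variable (σ : K →+* ℂ)

/-- The complex vector space `M_σ = ℂ ⊗ M`, where `ℂ` is an `𝓞 K`-algebra through `σ`. -/
def Fiber (M : Type v) [AddCommGroup M] [Module (𝓞 K) M] : Type v :=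
  @BaseChange K _ (algebraVia σ) M _ _

variable (M : Type v) [AddCommGroup M] [Module (𝓞 K) M] (N : Type w) [AddCommGroup N]
  [Module (𝓞 K) N]

instance : AddCommGroup (Fiber σ M) := @baseChangeAddCommGroup K _ (algebraVia σ) M _ _

instance : Module ℂ (Fiber σ M) := @baseChangeModule K _ (algebraVia σ) M _ _

instance [Module.Finite (𝓞 K) M] : Module.Finite ℂ (Fiber σ M) :=
  @baseChange_finite K _ (algebraVia σ) M _ _ _

variable {M N} in
/-- The element `z ⊗ e` of `M_σ`. -/
def Fiber.tmul (z : ℂ) (e : M) : Fiber σ M :=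
  @baseChangeTmul K _ (algebraVia σ) M _ _ z e

variable {M N} in
/-- The complex linear map `M_σ → N_σ` induced by an `𝓞 K`-linear map `M → N`. -/
def Fiber.map (g : M →ₗ[𝓞 K] N) : Fiber σ M →ₗ[ℂ] Fiber σ N :=
  @baseChangeMap K _ (algebraVia σ) M _ _ N _ _ g

/-- The canonical isomorphism `(𝓞 K)_σ = ℂ`, `z ⊗ a ↦ z σ(a)`. -/
def fiberUnit : Fiber σ (𝓞 K) ≃ₗ[ℂ] ℂ :=
  @baseChangeUnit K _ (algebraVia σ)

/-- The canonical isomorphism `(M ⊗ N)_σ = M_σ ⊗ N_σ`. -/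
def fiberTensor : Fiber σ (M ⊗[𝓞 K] N) ≃ₗ[ℂ] Fiber σ M ⊗[ℂ] Fiber σ N :=
  @baseChangeTensor K _ (algebraVia σ) M _ _ N _ _

/-- The canonical map from `(M^∨)_σ` to the complex dual of `M_σ`, where
`M^∨ = Hom(M, 𝓞 K)`. -/
def fiberDual : Fiber σ (Module.Dual (𝓞 K) M) →ₗ[ℂ] Module.Dual ℂ (Fiber σ M) :=
  @baseChangeDual K _ (algebraVia σ) M _ _

theorem fiberDual_injective [Module.Finite (𝓞 K) M] [Module.Projective (𝓞 K) M] :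
    Function.Injective (fiberDual σ M) :=
  @baseChangeDual_injective K _ (algebraVia σ) M _ _ _ _

/-- The canonical map from `M_K = K ⊗ M` to `M_σ`, `k ⊗ e ↦ σ(k) ⊗ e`. -/
def genericToFiber : K ⊗[𝓞 K] M →+ Fiber σ M :=
  (@baseChangeGeneric K _ (algebraVia σ) M _ _).toAddMonoidHom

end Fiber

/-! ### Hermitian modules over the ring of integers of a number field -/

/-- A hermitian `𝓞 K`-module (hermitian vector bundle over `Spec 𝓞 K`): a finitely generated
projective `𝓞 K`-module `E` with, for every embedding `σ : K → ℂ`, a positive definite hermitian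
form on the complex vector space `E_σ`. -/
structure HermitianModule (K : Type u) [Field K] where
  carrier : Type v
  [addCommGroup : AddCommGroup carrier]
  [module : Module (𝓞 K) carrier]
  [finite : Module.Finite (𝓞 K) carrier]
  [projective : Module.Projective (𝓞 K) carrier]
  core : ∀ σ : K →+* ℂ, InnerProductSpace.Core ℂ (Fiber σ carrier)

namespace HermitianModule

attribute [instance] addCommGroup module finite projective

variable {K : Type u} [Field K]

instance : CoeSort (HermitianModule.{u, v} K) (Type v) := ⟨carrier⟩

instance (E : HermitianModule.{u, v} K) (σ : K →+* ℂ) : NormedAddCommGroup (Fiber σ E) :=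
  (E.core σ).toNormedAddCommGroup

instance (E : HermitianModule.{u, v} K) (σ : K →+* ℂ) : InnerProductSpace ℂ (Fiber σ E) :=
  InnerProductSpace.ofCore (E.core σ).toCore

/-- The rank of `E`. -/
def rank (E : HermitianModule.{u, v} K) : ℕ := Module.finrank (𝓞 K) E

/-- `log ‖z‖_σ` for `z ∈ E_σ`, with the value `-∞` at `z = 0`. -/
def logNorm (E : HermitianModule.{u, v} K) (σ : K →+* ℂ) (z : Fiber σ E) : EReal :=
  ENNReal.log (ENNReal.ofReal ‖z‖)

/-- The trivial hermitian line bundle: `𝓞 K` with `‖1‖_σ = 1` for all `σ`. -/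
def unit (K : Type u) [Field K] : HermitianModule.{u, u} K where
  carrier := 𝓞 K
  core σ := coreComap (fiberUnit σ).toLinearMap (fiberUnit σ).injective

/-- The tensor product `E ⊗ F`; the metric on `(E ⊗ F)_σ = E_σ ⊗ F_σ` is determined by
`⟪a ⊗ b, c ⊗ d⟫ = ⟪a, c⟫ ⟪b, d⟫`. -/
def tensor (E : HermitianModule.{u, v} K) (F : HermitianModule.{u, w} K) :
    HermitianModule.{u, max v w} K where
  carrier := E ⊗[𝓞 K] F
  core σ := coreComap (fiberTensor σ E F).toLinearMap (fiberTensor σ E F).injective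

/-- The tensor power `H^{⊗ n}`. -/
def pow (H : HermitianModule.{u, u} K) : ℕ → HermitianModule.{u, u} K
  | 0 => unit K
  | n + 1 => (pow H n).tensor H

/-- The Riesz representative in `E_σ` of an element of `(E^∨)_σ`, a linear form on `E_σ`. -/
def riesz (E : HermitianModule.{u, v} K) (σ : K →+* ℂ) :
    Fiber σ (Module.Dual (𝓞 K) E) →ₗ⋆[ℂ] Fiber σ E :=
  haveI : CompleteSpace (Fiber σ E) := FiniteDimensional.complete ℂ _
  (InnerProductSpace.toDual ℂ (Fiber σ E)).symm.toLinearEquiv.toLinearMap.comp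
    (LinearMap.toContinuousLinearMap.toLinearMap.comp (fiberDual σ E))

theorem riesz_injective (E : HermitianModule.{u, v} K) (σ : K →+* ℂ) :
    Function.Injective (E.riesz σ) := by
  have : CompleteSpace (Fiber σ E) := FiniteDimensional.complete ℂ _
  exact (InnerProductSpace.toDual ℂ (Fiber σ E)).symm.injective.comp
    (LinearMap.toContinuousLinearMap.injective.comp (fiberDual_injective σ E))

/-- The dual `E^∨ = Hom(E, 𝓞 K)`, with the dual metric on `(E^∨)_σ = Hom(E_σ, ℂ)`. -/
def dual (E : HermitianModule.{u, v} K) : HermitianModule.{u, max u v} K where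
  carrier := Module.Dual (𝓞 K) E
  core σ := coreComapConj (E.riesz σ) (E.riesz_injective σ)

/-- The twist `E(x) = E ⊗ H^{⊗ x}`. -/
def twist (E : HermitianModule.{u, v} K) (H : HermitianModule.{u, u} K) (x : ℕ) :
    HermitianModule.{u, max u v} K :=
  E.tensor (H.pow x)

/-- For `P ∈ E^∨(x)` and `f ∈ E_σ`, the vector `⟨P, f⟩ ∈ (H^{⊗ x})_σ`: the contraction
`E^∨ ⊗ H^{⊗ x} → Hom(E, H^{⊗ x})`, extended to `σ`-fibres and evaluated at `f`. -/
def pairing (E : HermitianModule.{u, v} K) (H : HermitianModule.{u, u} K) (x : ℕ) (σ : K →+* ℂ)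
    (P : E.dual.twist H x) (f : Fiber σ E) : Fiber σ (H.pow x) :=
  Fiber.map σ (dualTensorHom (𝓞 K) E (H.pow x) P) f

/-! ### The smallest `K`-subspace containing a vector of `E_σ` -/

/-- The `K`-vector space `E_K = K ⊗ E`. -/
abbrev Generic (E : HermitianModule.{u, v} K) : Type (max u v) := K ⊗[𝓞 K] E

/-- The complexification `W_σ ⊆ E_σ` of a `K`-subspace `W ⊆ E_K`. -/
def complexify (E : HermitianModule.{u, v} K) (σ : K →+* ℂ) (W : Submodule K E.Generic) :
    Submodule ℂ (Fiber σ E) :=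
  Submodule.span ℂ (genericToFiber σ E '' W)

/-- The smallest `K`-subspace `W` of `E_K` containing `f ∈ E_σ`, i.e. with `f ∈ W_σ`. -/
def minimalSubspace (E : HermitianModule.{u, v} K) (σ : K →+* ℂ) (f : Fiber σ E) :
    Submodule K E.Generic :=
  sInf {W | f ∈ E.complexify σ W}

/-- The subspace `minimalSubspace` is indeed the smallest one. -/
theorem minimalSubspace_isLeast (E : HermitianModule.{u, v} K) (σ : K →+* ℂ) (f : Fiber σ E) :
    IsLeast {W | f ∈ E.complexify σ W} (E.minimalSubspace σ f) :=
  @isLeast_sInf_generic K _ (algebraVia σ) E _ _ f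

end HermitianModule

end ArakelovCriterion

end

noncomputable section

namespace ArakelovCriterion

/-! The method is a Liouville-type lower bound played against Cramer's rule. Let `W` be the minimal
subspace of `f`, of dimension `r`. Choose `r` vectors `w j` in `E` spanning `W` over `K`, and write
`f = ∑ φ j • w j` with complex coefficients, some `φ j` being non-zero. A non-zero form `u` on `H`
turns sections of `H^{⊗ x}` into elements of `𝓞 K`, so the values `u^{⊗ x}⟨P i, w j⟩` form an
integral `m × r` matrix. As the `P i` are `m` independent elements of a module of rank at most `m`,
its columns are independent and some `r × r` minor `Δ` is non-zero (`exists_det_twistForm_ne_zero`).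

All conjugates of the entries are at most `T = exp (c₁ x log x + O(x))`, while applying the matrix
to `φ` gives the images of the `F i`, of size at most `S = exp ((c₁ - c₂ m + c₃) x log x + O(x))` at
`σ₀`. Cramer's rule bounds `|φ j| |σ₀ Δ|` by `r! S T ^ (r - 1)`, and the norm of `Δ` being a
non-zero integer bounds `|σ₀ Δ|` from below by `(r! T ^ r) ^ (1 - d)`, with `d = [K : ℚ]`. Comparing
coefficients of `x log x` gives `c₂ m - c₃ ≤ d r c₁` (`degree_inequality`). The choices of `w`, `φ`
and `u` depend on `E`, `f`, `H` but not on `x`, and only affect terms of order `x`. -/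

theorem norm_lid_map_le {V W : Type*} [NormedAddCommGroup V] [InnerProductSpace ℂ V]
    [NormedAddCommGroup W] [InnerProductSpace ℂ W] (f : V →ₗ[ℂ] ℂ) (g : W →ₗ[ℂ] ℂ) {a b : ℝ}
    (hf : ∀ z, ‖f z‖ ≤ a * ‖z‖) (hg : ∀ z, ‖g z‖ ≤ b * ‖z‖) (ha : 0 ≤ a) (hb : 0 ≤ b)
    (t : V ⊗[ℂ] W) :
    ‖TensorProduct.lid ℂ ℂ (TensorProduct.map f g t)‖ ≤ a * b * ‖t‖ := by
  rw [TensorProduct.norm_lid]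
  -- For the Hilbert tensor norm, the operator norm of `f ⊗ g` is at most the product of the
  -- operator norms.
  have h := (TensorProduct.mapL (f.mkContinuous a hf) (g.mkContinuous b hg)).le_opNorm t
  rw [TensorProduct.mapL_apply] at h
  refine h.trans ?_
  refine mul_le_mul_of_nonneg_right ((TensorProduct.norm_mapL_le _ _).trans ?_) (norm_nonneg _)
  exact mul_le_mul (f.mkContinuous_norm_le ha hf) (g.mkContinuous_norm_le hb hg) (norm_nonneg _) ha

/-! ### Complex linear forms induced on fibres -/

section Fiber

variable {K : Type u} [Field K] (σ : K →+* ℂ)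
  {M : Type v} [AddCommGroup M] [Module (𝓞 K) M] {N : Type w} [AddCommGroup N] [Module (𝓞 K) N]

theorem Fiber.map_tmul (g : M →ₗ[𝓞 K] N) (z : ℂ) (e : M) :
    Fiber.map σ g (Fiber.tmul σ z e) = Fiber.tmul σ z (g e) :=
  rfl

theorem Fiber.tmul_zero (z : ℂ) : Fiber.tmul σ z (0 : M) = 0 :=
  let := algebraVia σ
  TensorProduct.tmul_zero _ _

theorem Fiber.tmul_add (z : ℂ) (a b : M) :
    Fiber.tmul σ z (a + b) = Fiber.tmul σ z a + Fiber.tmul σ z b :=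
  let := algebraVia σ
  TensorProduct.tmul_add _ _ _

theorem fiberUnit_tmul (z : ℂ) (a : 𝓞 K) : fiberUnit σ (Fiber.tmul σ z a) = z * σ a := by
  let := algebraVia σ
  change baseChangeUnit K (z ⊗ₜ a) = z * algebraMap K ℂ a
  simp only [baseChangeUnit, TensorProduct.AlgebraTensorModule.rid_tmul, Algebra.smul_def]
  rw [mul_comm]
  rfl

theorem fiberTensor_tmul (z : ℂ) (a : M) (b : N) :
    fiberTensor σ M N (Fiber.tmul σ z (a ⊗ₜ b)) = Fiber.tmul σ z a ⊗ₜ Fiber.tmul σ 1 b :=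
  rfl

theorem genericToFiber_tmul (k : K) (e : M) :
    genericToFiber σ M (k ⊗ₜ e) = Fiber.tmul σ (σ k) e :=
  rfl

theorem genericToFiber_smul (k : K) (t : K ⊗[𝓞 K] M) :
    genericToFiber σ M (k • t) = σ k • genericToFiber σ M t := by
  let := algebraVia σ
  change baseChangeGeneric M (k • t) = algebraMap K ℂ k • baseChangeGeneric M t
  rw [map_smul, algebraMap_smul]

/-- The vectors `1 ⊗ e` span the fibre over `ℂ`. This reduces identities between forms on fibres to
integral elements. -/
theorem Fiber.hom_ext {V : Type*} [AddCommGroup V] [Module ℂ V] {g h : Fiber σ M →ₗ[ℂ] V}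
    (H : ∀ e, g (Fiber.tmul σ 1 e) = h (Fiber.tmul σ 1 e)) : g = h := by
  let := algebraVia σ
  refine LinearMap.ext fun t => ?_
  refine TensorProduct.induction_on (motive := fun t : ℂ ⊗[𝓞 K] M => g t = h t) t
    ((map_zero g).trans (map_zero h).symm) (fun z e => ?_)
    fun a b ha hb => (map_add g _ _).trans ((congrArg₂ _ ha hb).trans (map_add h _ _).symm)
  have hz : (z ⊗ₜ[𝓞 K] e : ℂ ⊗[𝓞 K] M) = z • Fiber.tmul σ 1 e :=
    congrArg (· ⊗ₜ[𝓞 K] e) (mul_one z).symm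
  rw [hz]
  exact (map_smul g _ _).trans ((congrArg _ (H e)).trans (map_smul h _ _).symm)

/-- The complex linear form on `M_σ` induced by a linear form on `M`. -/
def fiberForm (α : M →ₗ[𝓞 K] 𝓞 K) : Fiber σ M →ₗ[ℂ] ℂ :=
  (fiberUnit σ).toLinearMap.comp (Fiber.map σ α)

theorem fiberForm_tmul (α : M →ₗ[𝓞 K] 𝓞 K) (z : ℂ) (e : M) :
    fiberForm σ α (Fiber.tmul σ z e) = z * σ (α e) :=
  fiberUnit_tmul σ z (α e)

theorem fiberForm_comp (α : N →ₗ[𝓞 K] 𝓞 K) (g : M →ₗ[𝓞 K] N) (z : Fiber σ M) :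
    fiberForm σ α (Fiber.map σ g z) = fiberForm σ (α.comp g) z := by
  refine LinearMap.congr_fun (f := (fiberForm σ α).comp (Fiber.map σ g)) ?_ z
  refine Fiber.hom_ext σ fun e => ?_
  rw [LinearMap.comp_apply, Fiber.map_tmul, fiberForm_tmul, fiberForm_tmul, LinearMap.comp_apply]

/-- The linear form `a ⊗ b ↦ α a * β b` on `M ⊗ N`. -/
def tensorForm (α : M →ₗ[𝓞 K] 𝓞 K) (β : N →ₗ[𝓞 K] 𝓞 K) : M ⊗[𝓞 K] N →ₗ[𝓞 K] 𝓞 K :=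
  (LinearMap.mul' (𝓞 K) (𝓞 K)).comp (TensorProduct.map α β)

@[simp]
theorem tensorForm_tmul (α : M →ₗ[𝓞 K] 𝓞 K) (β : N →ₗ[𝓞 K] 𝓞 K) (a : M) (b : N) :
    tensorForm α β (a ⊗ₜ b) = α a * β b := by
  simp [tensorForm]

/-- Expresses the form through `fiberTensor`, the map that defines the tensor metric, so that its
norm can be estimated by `norm_lid_map_le`. -/
theorem fiberForm_tensorForm (α : M →ₗ[𝓞 K] 𝓞 K) (β : N →ₗ[𝓞 K] 𝓞 K)
    (z : Fiber σ (M ⊗[𝓞 K] N)) :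
    fiberForm σ (tensorForm α β) z =
      TensorProduct.lid ℂ ℂ (TensorProduct.map (fiberForm σ α) (fiberForm σ β)
        (fiberTensor σ M N z)) := by
  refine LinearMap.congr_fun (g := (TensorProduct.lid ℂ ℂ).toLinearMap.comp
    ((TensorProduct.map (fiberForm σ α) (fiberForm σ β)).comp
      (fiberTensor σ M N).toLinearMap)) ?_ z
  refine Fiber.hom_ext σ fun e => ?_
  induction e with
  | zero =>
    rw [Fiber.tmul_zero, map_zero, map_zero]
  | add a b ha hb =>
    rw [Fiber.tmul_add, map_add, map_add, ha, hb]
  | tmul a b =>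
    simp only [LinearMap.comp_apply, LinearEquiv.coe_coe, fiberTensor_tmul,
      TensorProduct.map_tmul, fiberForm_tmul, tensorForm_tmul]
    simp

end Fiber

/-! ### Operator norms of forms on tensor powers and twists -/

namespace HermitianModule

variable {K : Type u} [Field K] (σ : K →+* ℂ)

theorem norm_tensor (E : HermitianModule.{u, v} K) (F : HermitianModule.{u, w} K)
    (z : Fiber σ (E.tensor F)) : ‖z‖ = ‖fiberTensor σ E F z‖ :=
  (norm_eq_sqrt_re_inner (𝕜 := ℂ) z).trans
    (norm_eq_sqrt_re_inner (𝕜 := ℂ) (fiberTensor σ E F z)).symm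

theorem norm_unit (z : Fiber σ (unit K)) : ‖z‖ = ‖fiberUnit σ z‖ :=
  (norm_eq_sqrt_re_inner (𝕜 := ℂ) z).trans
    (norm_eq_sqrt_re_inner (𝕜 := ℂ) (fiberUnit σ z)).symm

/-- The operator norm of the linear form on `E_σ` induced by a linear form on `E`. -/
def formNorm (E : HermitianModule.{u, v} K) (α : E →ₗ[𝓞 K] 𝓞 K) : ℝ :=
  ‖(LinearMap.toContinuousLinearMap (fiberForm σ α) : Fiber σ E →L[ℂ] ℂ)‖

theorem formNorm_nonneg (E : HermitianModule.{u, v} K) (α : E →ₗ[𝓞 K] 𝓞 K) :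
    0 ≤ E.formNorm σ α := by
  unfold formNorm
  exact ContinuousLinearMap.opNorm_nonneg _

theorem norm_fiberForm_le (E : HermitianModule.{u, v} K) (α : E →ₗ[𝓞 K] 𝓞 K)
    (z : Fiber σ E) : ‖fiberForm σ α z‖ ≤ E.formNorm σ α * ‖z‖ :=
  (LinearMap.toContinuousLinearMap (fiberForm σ α) : Fiber σ E →L[ℂ] ℂ).le_opNorm z

theorem formNorm_le (E : HermitianModule.{u, v} K) (α : E →ₗ[𝓞 K] 𝓞 K) {A : ℝ} (hA : 0 ≤ A)
    (h : ∀ z : Fiber σ E, ‖fiberForm σ α z‖ ≤ A * ‖z‖) : E.formNorm σ α ≤ A := by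
  unfold formNorm
  exact ContinuousLinearMap.opNorm_le_bound _ hA h

theorem formNorm_tensorForm_le (E : HermitianModule.{u, v} K) (F : HermitianModule.{u, w} K)
    (α : E →ₗ[𝓞 K] 𝓞 K) (β : F →ₗ[𝓞 K] 𝓞 K) :
    (E.tensor F).formNorm σ (tensorForm α β) ≤ E.formNorm σ α * F.formNorm σ β := by
  refine formNorm_le σ _ _ (mul_nonneg (E.formNorm_nonneg σ α) (F.formNorm_nonneg σ β)) fun z => ?_
  rw [norm_tensor]
  refine (congrArg norm (fiberForm_tensorForm σ α β z)).trans_le ?_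
  exact norm_lid_map_le _ _ (E.norm_fiberForm_le σ α) (F.norm_fiberForm_le σ β)
    (E.formNorm_nonneg σ α) (F.formNorm_nonneg σ β) _

/-- The `n`-th tensor power of a linear form on `H`. -/
def powForm (H : HermitianModule.{u, u} K) (u : H →ₗ[𝓞 K] 𝓞 K) :
    ∀ n, (H.pow n) →ₗ[𝓞 K] 𝓞 K
  | 0 => (LinearMap.id : 𝓞 K →ₗ[𝓞 K] 𝓞 K)
  | n + 1 => tensorForm (powForm H u n) u

theorem formNorm_powForm_le (H : HermitianModule.{u, u} K) (u : H →ₗ[𝓞 K] 𝓞 K) (n : ℕ) :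
    (H.pow n).formNorm σ (powForm H u n) ≤ H.formNorm σ u ^ n := by
  induction n with
  | zero =>
    rw [pow_zero]
    refine formNorm_le σ _ _ zero_le_one fun z => ?_
    rw [one_mul]
    refine le_of_eq (Eq.trans ?_ (norm_unit σ z).symm)
    refine congrArg norm (LinearMap.congr_fun (g := (fiberUnit σ).toLinearMap) ?_ z)
    refine Fiber.hom_ext σ fun e => ?_
    exact (fiberForm_tmul σ _ _ _).trans (fiberUnit_tmul σ _ _).symm
  | succ n ih =>
    rw [pow_succ]
    exact ((H.pow n).formNorm_tensorForm_le σ H _ u).trans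
      (mul_le_mul_of_nonneg_right ih (H.formNorm_nonneg σ u))

/-- The form is multiplicative on pure tensors and `𝓞 K` is a domain. -/
theorem powForm_ne_zero (H : HermitianModule.{u, u} K) {u : H →ₗ[𝓞 K] 𝓞 K} (hu : u ≠ 0) (n : ℕ) :
    ∃ h, powForm H u n h ≠ 0 := by
  induction n with
  | zero => exact ⟨(1 : 𝓞 K), one_ne_zero⟩
  | succ n ih =>
    obtain ⟨h, hh⟩ := ih
    obtain ⟨k, hk⟩ := DFunLike.ne_iff.1 hu
    exact ⟨h ⊗ₜ k, fun h0 => mul_ne_zero hh hk ((tensorForm_tmul _ u h k).symm.trans h0)⟩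

/-- The linear form `P ↦ u^{⊗ x}(⟨P, w⟩)` on `E^∨(x)`. -/
def twistForm (E : HermitianModule.{u, v} K) (H : HermitianModule.{u, u} K)
    (u : H →ₗ[𝓞 K] 𝓞 K) (x : ℕ) (w : E) : E.dual.twist H x →ₗ[𝓞 K] 𝓞 K :=
  tensorForm (Module.Dual.eval (𝓞 K) E w) (powForm H u x)

theorem twistForm_apply (E : HermitianModule.{u, v} K) (H : HermitianModule.{u, u} K)
    (u : H →ₗ[𝓞 K] 𝓞 K) (x : ℕ) (w : E) (P : E.dual.twist H x) :
    twistForm E H u x w P = powForm H u x (dualTensorHom (𝓞 K) E (H.pow x) P w) := by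
  change tensorForm (Module.Dual.eval (𝓞 K) E w) (powForm H u x)
    (P : Module.Dual (𝓞 K) E ⊗[𝓞 K] H.pow x) = _
  refine LinearMap.congr_fun (g := (powForm H u x).comp
    ((LinearMap.applyₗ w).comp (dualTensorHom (𝓞 K) E (H.pow x)))) ?_ P
  ext φ h
  simp

theorem formNorm_twistForm_le (E : HermitianModule.{u, v} K) (H : HermitianModule.{u, u} K)
    (u : H →ₗ[𝓞 K] 𝓞 K) (x : ℕ) (w : E) :
    (E.dual.twist H x).formNorm σ (twistForm E H u x w) ≤
      E.dual.formNorm σ (Module.Dual.eval (𝓞 K) E w) * H.formNorm σ u ^ x :=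
  (E.dual.formNorm_tensorForm_le σ (H.pow x) _ _).trans
    (mul_le_mul_of_nonneg_left (formNorm_powForm_le σ H u x) (E.dual.formNorm_nonneg σ _))

theorem norm_twistForm_le (E : HermitianModule.{u, v} K) (H : HermitianModule.{u, u} K)
    (u : H →ₗ[𝓞 K] 𝓞 K) (x : ℕ) (w : E) (P : E.dual.twist H x) :
    ‖σ (twistForm E H u x w P)‖ ≤
      E.dual.formNorm σ (Module.Dual.eval (𝓞 K) E w) * H.formNorm σ u ^ x *
        ‖(Fiber.tmul σ 1 P : Fiber σ (E.dual.twist H x))‖ := by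
  have h := (E.dual.twist H x).norm_fiberForm_le σ (twistForm E H u x w) (Fiber.tmul σ 1 P)
  rw [fiberForm_tmul, one_mul] at h
  exact h.trans (mul_le_mul_of_nonneg_right (formNorm_twistForm_le σ E H u x w) (norm_nonneg _))

/-- Links the two kinds of data: smallness of `⟨P, f⟩` becomes smallness of a complex combination,
with coefficients independent of `P` and `x`, of the conjugates of algebraic integers. -/
theorem sum_twistForm_eq {ι : Type*} (s : Finset ι) (E : HermitianModule.{u, v} K)
    (H : HermitianModule.{u, u} K) (u : H →ₗ[𝓞 K] 𝓞 K) (x : ℕ) (w : ι → E) (φ : ι → ℂ)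
    (P : E.dual.twist H x) :
    fiberForm σ (powForm H u x) (E.pairing H x σ P (∑ j ∈ s, φ j • Fiber.tmul σ 1 (w j))) =
      ∑ j ∈ s, φ j * σ (twistForm E H u x (w j) P) := by
  rw [pairing, fiberForm_comp, map_sum]
  refine Finset.sum_congr rfl fun j _ => ?_
  rw [map_smul, fiberForm_tmul, one_mul, smul_eq_mul, twistForm_apply, LinearMap.comp_apply]

theorem norm_sum_twistForm_le {ι : Type*} (s : Finset ι) (E : HermitianModule.{u, v} K)
    (H : HermitianModule.{u, u} K) (u : H →ₗ[𝓞 K] 𝓞 K) (x : ℕ) (w : ι → E) (φ : ι → ℂ)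
    (P : E.dual.twist H x) :
    ‖∑ j ∈ s, φ j * σ (twistForm E H u x (w j) P)‖ ≤ H.formNorm σ u ^ x *
      ‖E.pairing H x σ P (∑ j ∈ s, φ j • Fiber.tmul σ 1 (w j))‖ := by
  rw [← sum_twistForm_eq]
  exact ((H.pow x).norm_fiberForm_le σ _ _).trans
    (mul_le_mul_of_nonneg_right (formNorm_powForm_le σ H u x) (norm_nonneg _))

end HermitianModule

end ArakelovCriterion


/-! ### Ranks over a domain, non-zero minors, integral bases -/

theorem finrank_tensorProduct_of_isDomain {R A B : Type*} [CommRing R] [IsDomain R]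
    [AddCommGroup A] [Module R A] [AddCommGroup B] [Module R B] :
    Module.finrank R (A ⊗[R] B) = Module.finrank R A * Module.finrank R B := by
  let F := FractionRing R
  rw [← (TensorProduct.isBaseChange R (A ⊗[R] B) F).finrank_eq,
    ← (TensorProduct.isBaseChange R A F).finrank_eq,
    ← (TensorProduct.isBaseChange R B F).finrank_eq,
    (TensorProduct.AlgebraTensorModule.distribBaseChange R F A B).finrank_eq,
    Module.finrank_tensorProduct]

/-- A form on `M` is determined by its extension to the fraction field, so the dual embeds in a
vector space of dimension the rank of `M`. -/
theorem finrank_dual_le_of_isDomain {R : Type*} {M : Type*} [CommRing R] [IsDomain R]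
    [AddCommGroup M] [Module R M] [Module.Finite R M] :
    Module.finrank R (Module.Dual R M) ≤ Module.finrank R M := by
  let F := FractionRing R
  have hinj : Function.Injective (Module.Dual.baseChange F : Module.Dual R M →ₗ[R] _) := by
    intro φ ψ h
    ext e
    have h' := LinearMap.congr_fun h (1 ⊗ₜ e)
    simp only [Module.Dual.baseChange_apply_tmul] at h'
    exact FaithfulSMul.algebraMap_injective R F (by simpa [Algebra.smul_def] using h')
  have h₁ := LinearMap.lift_rank_le_of_injective _ hinj
  rw [← IsFractionRing.rank_right_eq R F (N := Module.Dual F (F ⊗[R] M))] at h₁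
  have h₂ := Cardinal.toNat_le_toNat h₁ (by simpa using Module.rank_lt_aleph0 F _)
  rw [Cardinal.toNat_lift, Cardinal.toNat_lift] at h₂
  rw [← (TensorProduct.isBaseChange R M F).finrank_eq, ← Subspace.dual_finrank_eq (K := F)]
  exact h₂

/-- If `l q ≠ 0`, then `q` is independent of the `P i`, all of which lie in the kernel; this would
give `m + 1` independent elements. -/
theorem LinearIndependent.eq_zero_of_finrank_le {R : Type*} {M : Type*} [CommRing R] [IsDomain R]
    [AddCommGroup M] [Module R M] [Module.Finite R M] {m : ℕ} {P : Fin m → M}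
    (hP : LinearIndependent R P) (hm : Module.finrank R M ≤ m) {l : M →ₗ[R] R}
    (hl : ∀ i, l (P i) = 0) : l = 0 := by
  by_contra h
  obtain ⟨q, hq⟩ := DFunLike.ne_iff.1 h
  have hspan : ∀ y ∈ Submodule.span R (Set.range P), l y = 0 := fun y hy =>
    (Submodule.span_le (p := LinearMap.ker l)).2 (by rintro _ ⟨i, rfl⟩; exact hl i) hy
  have hli := LinearIndependent.finCons' q P hP fun c y hy hc => by
    have := congrArg l hc
    rw [map_add, map_smul, hspan y hy, add_zero, map_zero, smul_eq_mul] at this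
    exact (mul_eq_zero.1 this).resolve_right hq
  have := hli.fintype_card_le_finrank
  rw [Fintype.card_fin] at this
  omega

/-- Injectivity makes the row rank equal to `r`, so `r` independent rows can be extracted. -/
theorem Matrix.exists_submatrix_det_ne_zero {F ι : Type*} [Field F] [Finite ι] {r : ℕ}
    (A : Matrix ι (Fin r) F) (hA : ∀ v, A.mulVec v = 0 → v = 0) :
    ∃ g : Fin r → ι, (A.submatrix g id).det ≠ 0 := by
  have hrank : Module.finrank F (Submodule.span F (Set.range A)) = r := by
    have h := A.rank_eq_finrank_span_row
    rw [Matrix.rank, LinearMap.finrank_range_of_inj, Module.finrank_fin_fun] at h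
    · exact h.symm
    · exact (injective_iff_map_eq_zero _).2 hA
  obtain ⟨κ, a, ha, hspan, hli⟩ := exists_linearIndependent' F (A : ι → Fin r → F)
  have : Finite κ := Finite.of_injective a ha
  have := Fintype.ofFinite κ
  have hcard : Fintype.card κ = r := by
    rw [linearIndependent_iff_card_eq_finrank_span.1 hli, Set.finrank, hspan, hrank]
  let e := (Fintype.equivFinOfCardEq hcard).symm
  refine ⟨a ∘ e, ?_⟩
  have h := hli.comp e e.injective
  exact ((Matrix.isUnit_iff_isUnit_det _).1
    (Matrix.linearIndependent_rows_iff_isUnit.1 h)).ne_zero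

/-- A kernel vector over the fraction field becomes one over `R` after clearing denominators, which
reduces to the case of a field. -/
theorem Matrix.exists_submatrix_det_ne_zero_of_isDomain {R ι : Type*} [CommRing R] [IsDomain R]
    [Finite ι] {r : ℕ} (A : Matrix ι (Fin r) R) (hA : ∀ v, A.mulVec v = 0 → v = 0) :
    ∃ g : Fin r → ι, (A.submatrix g id).det ≠ 0 := by
  let F := FractionRing R
  obtain ⟨g, hg⟩ := Matrix.exists_submatrix_det_ne_zero (A.map (algebraMap R F)) fun v hv => by
    obtain ⟨b, hb⟩ := IsLocalization.exist_integer_multiples_of_finite (nonZeroDivisors R) v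
    choose c hc using hb
    have hc0 : c = 0 := hA c <| by
      funext i
      apply FaithfulSMul.algebraMap_injective R F
      have h := congrFun hv i
      simp only [Matrix.mulVec, dotProduct, Matrix.map_apply, Pi.zero_apply] at h ⊢
      rw [map_sum, map_zero]
      simp only [map_mul, hc, Algebra.smul_def, mul_left_comm _ (algebraMap R F b)]
      rw [← Finset.mul_sum, h, mul_zero]
    funext j
    have h := hc j
    rw [hc0, Pi.zero_apply, map_zero] at h
    exact (smul_eq_zero.1 h.symm).resolve_left (nonZeroDivisors.coe_ne_zero b)
  refine ⟨g, fun h => hg ?_⟩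
  rw [Matrix.submatrix_map, ← RingHom.mapMatrix_apply, ← RingHom.map_det, h, map_zero]

/-- Multiplying a basis of `W` by a common denominator brings it into the image of `M` without
changing its span. -/
theorem exists_integral_basis {R F M V : Type*} [CommRing R] [IsDomain R] [Field F] [Algebra R F]
    [IsFractionRing R F] [AddCommGroup M] [Module R M] [AddCommGroup V] [Module R V] [Module F V]
    [IsScalarTower R F V] [FiniteDimensional F V] (g : M →ₗ[R] V)
    [IsLocalizedModule (nonZeroDivisors R) g] (W : Submodule F V) :
    ∃ w : Fin (Module.finrank F W) → M, LinearIndependent R w ∧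
      Submodule.span F (Set.range fun j => g (w j)) = W := by
  let b := Module.finBasis F W
  obtain ⟨s, hs⟩ := IsLocalizedModule.exist_integer_multiples_of_finite (nonZeroDivisors R) g
    fun j => (b j : V)
  choose w hw using hs
  have hs0 : algebraMap R F s ≠ 0 :=
    IsLocalization.to_map_ne_zero_of_mem_nonZeroDivisors F le_rfl s.2
  let b' := b.unitsSMul fun _ => Units.mk0 _ hs0
  have hw' : (fun j => g (w j)) = W.subtype ∘ b' := by
    funext j
    rw [Function.comp_apply, Module.Basis.unitsSMul_apply, Units.smul_def, map_smul]
    exact (hw j).trans (algebraMap_smul F (s : R) (b j : V)).symm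
  refine ⟨w, ?_, ?_⟩
  · have h : LinearIndependent F fun j => g (w j) := by
      rw [hw']
      exact b'.linearIndependent.map' W.subtype W.ker_subtype
    have h' : LinearIndependent R fun j => g (w j) :=
      h.restrict_scalars <| by
        simpa only [← Algebra.algebraMap_eq_smul_one'] using IsFractionRing.injective R F
    exact LinearIndependent.of_comp g h'
  · rw [hw', Set.range_comp, ← Submodule.map_span, b'.span_eq, Submodule.map_top,
      Submodule.range_subtype]


/-! ### Liouville's inequality and Cramer's rule -/

section NumberField

variable {K : Type u} [Field K] [NumberField K]

/-- The norm of `α` is a non-zero rational integer, and all its conjugates but the one at `σ` are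
bounded by `B`. -/
theorem NumberField.one_le_norm_mul_pow {α : 𝓞 K} (hα : α ≠ 0) (σ : K →+* ℂ) {B : ℝ}
    (hB : ∀ τ : K →+* ℂ, ‖τ α‖ ≤ B) : 1 ≤ ‖σ α‖ * B ^ (Module.finrank ℚ K - 1) := by
  have h₁ : 1 ≤ ‖Algebra.norm ℚ (α : K)‖ := by
    rw [← Algebra.coe_norm_int, ← Rat.norm_cast_real, Rat.cast_intCast, Real.norm_eq_abs,
      ← Int.cast_abs]
    exact_mod_cast Int.one_le_abs ((Algebra.norm_ne_zero_iff (R := ℤ)).2 hα)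
  have h₂ : NumberField.house (α : K) ≤ B :=
    (pi_norm_le_iff_of_nonneg ((norm_nonneg _).trans (hB σ))).2 hB
  exact h₁.trans ((NumberField.norm_norm_le_norm_mul_house_pow _ σ).trans
    (mul_le_mul_of_nonneg_left (pow_le_pow_left₀ (NumberField.house_nonneg _) h₂ _)
      (norm_nonneg _)))

theorem Matrix.norm_det_le {r : ℕ} {A : Matrix (Fin r) (Fin r) ℂ} {T : ℝ}
    (hA : ∀ i j, ‖A i j‖ ≤ T) : ‖A.det‖ ≤ r.factorial * T ^ r := by
  have h := Matrix.det_le (abv := NormedField.toAbsoluteValue ℂ) hA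
  rw [Fintype.card_fin, nsmul_eq_mul] at h
  exact h

/-- By Cramer's rule `φ j * det A` is the determinant with column `j` replaced by `A φ`. Keeping a
factor `T` on the left avoids the exponent `r - 1`. -/
theorem Matrix.norm_det_mul_le {r : ℕ} {A : Matrix (Fin r) (Fin r) ℂ} {T S : ℝ} (hT : 0 < T)
    (hS : 0 < S) (hA : ∀ i j, ‖A i j‖ ≤ T) {φ : Fin r → ℂ} (hφ : ∀ i, ‖A.mulVec φ i‖ ≤ S)
    (j : Fin r) : T * ‖φ j‖ * ‖A.det‖ ≤ S * (r.factorial * T ^ r) := by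
  have h₁ : A.cramer (A.mulVec φ) j = A.det * φ j := by
    rw [Matrix.cramer_eq_adjugate_mulVec, Matrix.mulVec_mulVec, Matrix.adjugate_mul,
      Matrix.smul_mulVec, Matrix.one_mulVec, Pi.smul_apply, smul_eq_mul]
  -- Scaling the new column by `T / S` makes every entry at most `T`, so one uniform determinant
  -- bound applies.
  have h₂ : A.cramer (((T / S : ℝ) : ℂ) • A.mulVec φ) j = (T / S : ℝ) * (A.det * φ j) := by
    rw [map_smul, Pi.smul_apply, h₁, smul_eq_mul]
  have h₃ : ‖A.cramer (((T / S : ℝ) : ℂ) • A.mulVec φ) j‖ ≤ r.factorial * T ^ r := by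
    rw [Matrix.cramer_apply]
    refine Matrix.norm_det_le fun i k => ?_
    rw [Matrix.updateCol_apply]
    split_ifs
    · rw [Pi.smul_apply, norm_smul, Complex.norm_real, Real.norm_of_nonneg (by positivity)]
      calc T / S * ‖A.mulVec φ i‖ ≤ T / S * S := by gcongr; exact hφ i
        _ = T := by field_simp
    · exact hA i k
  rw [h₂, norm_mul, norm_mul, Complex.norm_real, Real.norm_of_nonneg (by positivity)] at h₃
  calc T * ‖φ j‖ * ‖A.det‖ = S * (T / S * (‖A.det‖ * ‖φ j‖)) := by field_simp
    _ ≤ S * (r.factorial * T ^ r) := by gcongr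

/-- One factor `r! T ^ r` comes from Cramer's rule at `σ`, the other `d - 1` from the remaining
conjugates of the determinant. -/
theorem NumberField.mul_norm_le_of_det_ne_zero {r : ℕ} {A : Matrix (Fin r) (Fin r) (𝓞 K)}
    (hdet : A.det ≠ 0) (σ : K →+* ℂ) {T S : ℝ} (hT : 0 < T) (hS : 0 < S)
    (hA : ∀ (τ : K →+* ℂ) i j, ‖τ (A i j)‖ ≤ T) {φ : Fin r → ℂ}
    (hφ : ∀ i, ‖∑ j, φ j * σ (A i j)‖ ≤ S) (j : Fin r) :
    T * ‖φ j‖ ≤ S * (r.factorial * T ^ r) ^ Module.finrank ℚ K := by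
  have hmap (τ : K →+* ℂ) :
      τ A.det = (A.map fun a => τ (algebraMap (𝓞 K) K a)).det :=
    (τ.comp (algebraMap (𝓞 K) K)).map_det A
  have h₁ := NumberField.one_le_norm_mul_pow hdet σ (B := r.factorial * T ^ r) fun τ => by
    rw [hmap]
    exact Matrix.norm_det_le fun i k => hA τ i k
  have h₂ := Matrix.norm_det_mul_le hT hS (A := A.map fun a => σ (algebraMap (𝓞 K) K a))
    (fun i k => hA σ i k) (φ := φ) (fun i => by
      refine le_of_eq_of_le (congrArg norm ?_) (hφ i)
      simp only [Matrix.mulVec, dotProduct, Matrix.map_apply, mul_comm]) j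
  rw [← hmap] at h₂
  have hd : Module.finrank ℚ K = Module.finrank ℚ K - 1 + 1 :=
    (Nat.succ_pred_eq_of_pos Module.finrank_pos).symm
  calc T * ‖φ j‖ ≤ T * ‖φ j‖ *
        (‖σ A.det‖ * (r.factorial * T ^ r) ^ (Module.finrank ℚ K - 1)) :=
        le_mul_of_one_le_right (by positivity) h₁
    _ = T * ‖φ j‖ * ‖σ A.det‖ * (r.factorial * T ^ r) ^ (Module.finrank ℚ K - 1) := by ring
    _ ≤ S * (r.factorial * T ^ r) * (r.factorial * T ^ r) ^ (Module.finrank ℚ K - 1) := by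
        gcongr
    _ = _ := by rw [mul_assoc, ← pow_succ', ← hd]

end NumberField

/-! ### Comparison of growth in `x` -/

theorem nonneg_of_eventually_nonneg_mul_log {a b c : ℝ}
    (h : ∀ᶠ x : ℕ in Filter.atTop, 0 ≤ a * (x * Real.log x) + b * x + c) : 0 ≤ a := by
  by_contra! ha
  have hlim : Filter.Tendsto (fun x : ℕ => a * Real.log x) Filter.atTop Filter.atBot :=
    (Real.tendsto_log_atTop.comp tendsto_natCast_atTop_atTop).const_mul_atTop_of_neg ha
  -- For `x ≥ 1` the constant `c` is at most `|c| * x`, so it can be absorbed into the linear term.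
  obtain ⟨x, hx, hx₁, hx₂⟩ := (h.and ((Filter.eventually_ge_atTop 1).and
    (hlim.eventually_lt_atBot (-(b + |c|))))).exists
  have hx₁' : (1 : ℝ) ≤ x := by exact_mod_cast hx₁
  have h₁ : (a * Real.log x + (b + |c|)) * x < 0 :=
    mul_neg_of_neg_of_pos (by linarith) (by linarith)
  have h₂ : c ≤ |c| * x := (le_abs_self c).trans (le_mul_of_one_le_right (abs_nonneg c) hx₁')
  linarith

theorem ENNReal.le_exp_of_log_ofReal_le {t y : ℝ}
    (h : ENNReal.log (ENNReal.ofReal t) ≤ (y : EReal)) :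
    t ≤ Real.exp y := by
  rcases le_or_gt t 0 with ht | ht
  · exact ht.trans (Real.exp_pos y).le
  · rw [ENNReal.log_ofReal_of_pos ht, EReal.coe_le_coe_iff] at h
    exact (Real.log_le_iff_le_exp ht).1 h

/-- After taking logarithms, the conclusion is the sign of the coefficient of `x log x`; `D`, `U`,
`t`, `r!`, `b₁` and `b₂` contribute only `O(x)`. -/
theorem nonneg_of_eventually_mul_le {d r : ℕ} {p q b₁ b₂ D U t : ℝ} (hD : 0 < D) (hU : 0 < U)
    (ht : 0 < t)
    (h : ∀ᶠ x : ℕ in Filter.atTop,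
      D * U ^ x * Real.exp (p * (x * Real.log x) + b₁ * x) * t ≤
        U ^ x * Real.exp (q * (x * Real.log x) + b₂ * x) *
          (r.factorial * (D * U ^ x * Real.exp (p * (x * Real.log x) + b₁ * x)) ^ r) ^ d) :
    0 ≤ (d * r - 1) * p + q := by
  refine nonneg_of_eventually_nonneg_mul_log
    (b := (d * r - 1) * (b₁ + Real.log U) + (b₂ + Real.log U))
    (c := d * Real.log r.factorial + (d * r - 1) * Real.log D - Real.log t) ?_
  filter_upwards [h] with x hx
  have hlog := Real.log_le_log (by positivity) hx
  have h₁ : ∀ y, Real.log (U ^ x * Real.exp y) = x * Real.log U + y := fun y => by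
    rw [Real.log_mul (by positivity) (by positivity), Real.log_pow, Real.log_exp]
  have h₂ : ∀ y, Real.log (D * U ^ x * Real.exp y) = Real.log D + (x * Real.log U + y) :=
    fun y => by rw [mul_assoc, Real.log_mul hD.ne' (by positivity), h₁]
  rw [Real.log_mul (by positivity) ht.ne', h₂, Real.log_mul (by positivity) (by positivity), h₁,
    Real.log_pow, Real.log_mul (by positivity) (by positivity), Real.log_pow, h₂] at hlog
  linarith


/-! ### Application to hermitian modules -/

namespace ArakelovCriterion

namespace HermitianModule

variable {K : Type u} [Field K]

theorem rank_pow [NumberField K] (H : HermitianModule.{u, u} K) (hH : H.rank = 1) (n : ℕ) :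
    (H.pow n).rank = 1 := by
  induction n with
  | zero => exact Module.finrank_self (𝓞 K)
  | succ n ih =>
    refine (finrank_tensorProduct_of_isDomain (R := 𝓞 K) (A := H.pow n) (B := H)).trans ?_
    rw [show Module.finrank (𝓞 K) (H.pow n) = 1 from ih, one_mul]
    exact hH

theorem rank_dual_twist_le [NumberField K] (E : HermitianModule.{u, v} K)
    (H : HermitianModule.{u, u} K) (hH : H.rank = 1) (x : ℕ) :
    (E.dual.twist H x).rank ≤ E.rank := by
  refine (finrank_tensorProduct_of_isDomain (R := 𝓞 K) (A := E.dual) (B := H.pow x)).trans_le ?_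
  rw [show Module.finrank (𝓞 K) (H.pow x) = 1 from H.rank_pow hH x, mul_one]
  exact finrank_dual_le_of_isDomain (R := 𝓞 K) (M := E)

theorem exists_form_ne_zero (H : HermitianModule.{u, u} K) (hH : H.rank = 1) :
    ∃ u : H →ₗ[𝓞 K] 𝓞 K, u ≠ 0 := by
  have : Nontrivial H := by
    refine Module.nontrivial_of_finrank_pos (R := 𝓞 K) ?_
    rw [show Module.finrank (𝓞 K) H = 1 from hH]
    exact one_pos
  obtain ⟨h, hh⟩ := exists_ne (0 : H)
  obtain ⟨u, hu⟩ := Module.Projective.exists_dual_ne_zero (𝓞 K) hh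
  exact ⟨u, fun h0 => hu (LinearMap.congr_fun h0 h)⟩

theorem twistForm_ne_zero (E : HermitianModule.{u, v} K) (H : HermitianModule.{u, u} K)
    {u : H →ₗ[𝓞 K] 𝓞 K} (hu : u ≠ 0) (x : ℕ) {e : E} (he : e ≠ 0) :
    twistForm E H u x e ≠ 0 := by
  obtain ⟨φ, hφ⟩ := Module.Projective.exists_dual_ne_zero (𝓞 K) he
  obtain ⟨h, hh⟩ := powForm_ne_zero H hu x
  intro h0
  have := LinearMap.congr_fun h0 (φ ⊗ₜ[𝓞 K] h)
  exact mul_ne_zero hφ hh ((tensorForm_tmul (Module.Dual.eval (𝓞 K) E e) _ φ h).symm.trans this)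

theorem twistForm_sum_smul {ι : Type*} (s : Finset ι) (E : HermitianModule.{u, v} K)
    (H : HermitianModule.{u, u} K) (u : H →ₗ[𝓞 K] 𝓞 K) (x : ℕ) (w : ι → E) (c : ι → 𝓞 K)
    (P : E.dual.twist H x) :
    twistForm E H u x (∑ j ∈ s, c j • w j) P = ∑ j ∈ s, c j * twistForm E H u x (w j) P := by
  simp only [twistForm_apply, map_sum, map_smul, smul_eq_mul]

/-- A relation `c` between the columns says that the form attached to `∑ c j • w j` kills every `P
i`. By the rank bound this form is zero, contradicting `twistForm_ne_zero`. -/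
theorem exists_det_twistForm_ne_zero [NumberField K] (E : HermitianModule.{u, v} K)
    (H : HermitianModule.{u, u} K) (hH : H.rank = 1) {u : H →ₗ[𝓞 K] 𝓞 K} (hu : u ≠ 0) (x : ℕ)
    {r : ℕ} {w : Fin r → E} (hw : LinearIndependent (𝓞 K) w) {P : Fin E.rank → E.dual.twist H x}
    (hP : LinearIndependent (𝓞 K) P) :
    ∃ g : Fin r → Fin E.rank,
      (Matrix.of fun i j => twistForm E H u x (w j) (P (g i))).det ≠ 0 := by
  refine Matrix.exists_submatrix_det_ne_zero_of_isDomain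
    (Matrix.of fun i j => twistForm E H u x (w j) (P i)) fun c hc => ?_
  by_contra hc0
  have he : ∑ j, c j • w j ≠ 0 := fun h =>
    hc0 (funext (Fintype.linearIndependent_iff.1 hw c h))
  refine twistForm_ne_zero E H hu x he
    (hP.eq_zero_of_finrank_le (E.rank_dual_twist_le H hH x) fun i => ?_)
  rw [twistForm_sum_smul]
  refine Eq.trans (Finset.sum_congr rfl fun j _ => mul_comm _ _) (congrFun hc i)

theorem exists_eq_sum_smul_tmul (E : HermitianModule.{u, v} K) (σ : K →+* ℂ)
    {ι : Type*} [Fintype ι] {w : ι → E} {W : Submodule K E.Generic}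
    (hw : Submodule.span K (Set.range fun j => TensorProduct.mk (𝓞 K) K E 1 (w j)) = W)
    {f : Fiber σ E} (hf : f ∈ E.complexify σ W) :
    ∃ φ : ι → ℂ, ∑ j, φ j • Fiber.tmul σ 1 (w j) = f := by
  rw [← Submodule.mem_span_range_iff_exists_fun]
  refine (Submodule.span_le.2 ?_) hf
  rintro _ ⟨t, ht, rfl⟩
  rw [SetLike.mem_coe, ← hw] at ht
  induction ht using Submodule.span_induction with
  | mem t ht =>
    obtain ⟨j, rfl⟩ := ht
    refine Submodule.subset_span ⟨j, ?_⟩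
    change _ = genericToFiber σ E (1 ⊗ₜ w j)
    rw [genericToFiber_tmul, map_one]
  | zero => rw [map_zero]; exact Submodule.zero_mem _
  | add a b _ _ ha hb => rw [map_add]; exact Submodule.add_mem _ ha hb
  | smul k a _ ha => rw [genericToFiber_smul]; exact Submodule.smul_mem _ _ ha

/-- Here `T = D * U ^ x * exp (p x log x + b₁ x)` and `S = U ^ x * exp (q x log x + b₂ x)`, where
`U` bounds the norms of `u` and `D` those of evaluation at the `w k`, over all embeddings. -/
theorem degree_inequality [NumberField K] (E : HermitianModule.{u, v} K)
    (H : HermitianModule.{u, u} K) (hH : H.rank = 1) (σ₀ : K →+* ℂ) {f : Fiber σ₀ E} (hf : f ≠ 0)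
    (p q b₁ b₂ : ℝ)
    (h : ∀ᶠ x : ℕ in Filter.atTop, ∃ P : Fin E.rank → E.dual.twist H x,
      LinearIndependent (𝓞 K) P ∧
      (∀ i (σ : K →+* ℂ), ‖(Fiber.tmul σ 1 (P i) : Fiber σ (E.dual.twist H x))‖ ≤
        Real.exp (p * (x * Real.log x) + b₁ * x)) ∧
      ∀ i, ‖E.pairing H x σ₀ (P i) f‖ ≤ Real.exp (q * (x * Real.log x) + b₂ * x)) :
    0 ≤ (Module.finrank ℚ K * Module.finrank K (E.minimalSubspace σ₀ f) - 1) * p + q := by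
  obtain ⟨w, hw, hspan⟩ := exists_integral_basis (R := 𝓞 K) (TensorProduct.mk (𝓞 K) K E 1)
    (E.minimalSubspace σ₀ f)
  generalize hr : Module.finrank K (E.minimalSubspace σ₀ f) = r at w hw hspan ⊢
  obtain ⟨φ, hφ⟩ := E.exists_eq_sum_smul_tmul σ₀ hspan (E.minimalSubspace_isLeast σ₀ f).1
  obtain ⟨j, hj⟩ : ∃ j, φ j ≠ 0 := by
    by_contra! h0
    exact hf (by simp [← hφ, h0])
  obtain ⟨u, hu⟩ := H.exists_form_ne_zero hH
  obtain ⟨U, hU, hU'⟩ : ∃ U : ℝ, 0 < U ∧ ∀ σ, H.formNorm σ u ≤ U := by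
    obtain ⟨U, hU⟩ := (Set.finite_range fun σ => H.formNorm σ u).bddAbove
    exact ⟨max U 1, by positivity, fun σ => (hU ⟨σ, rfl⟩).trans (le_max_left _ _)⟩
  obtain ⟨D, hD, hD'⟩ : ∃ D : ℝ, 0 < D ∧
      ∀ (σ : K →+* ℂ) (k : Fin r), E.dual.formNorm σ (Module.Dual.eval (𝓞 K) E (w k)) ≤ D := by
    obtain ⟨D, hD⟩ := (Set.finite_range fun t : (K →+* ℂ) × Fin r =>
      E.dual.formNorm t.1 (Module.Dual.eval (𝓞 K) E (w t.2))).bddAbove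
    exact ⟨max D 1, by positivity, fun σ k => (hD ⟨(σ, k), rfl⟩).trans (le_max_left _ _)⟩
  refine nonneg_of_eventually_mul_le (d := Module.finrank ℚ K) (r := r) (b₁ := b₁) (b₂ := b₂) hD hU
    (norm_pos_iff.2 hj) ?_
  filter_upwards [h] with x ⟨P, hP, hP₁, hP₂⟩
  obtain ⟨g, hg⟩ := E.exists_det_twistForm_ne_zero H hH hu x hw hP
  exact NumberField.mul_norm_le_of_det_ne_zero hg σ₀ (by positivity) (by positivity) (φ := φ)
    (fun τ i k => (norm_twistForm_le τ E H u x (w k) (P (g i))).trans <| by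
      gcongr
      · exact pow_nonneg (H.formNorm_nonneg τ u) x
      · exact hD' τ k
      · exact H.formNorm_nonneg τ u
      · exact hU' τ
      · exact hP₁ (g i) τ)
    (fun i => (norm_sum_twistForm_le σ₀ Finset.univ E H u x w φ (P (g i))).trans <| by
      rw [hφ]
      gcongr
      · exact H.formNorm_nonneg σ₀ u
      · exact hU' σ₀
      · exact hP₂ (g i)) j

theorem norm_le_exp_of_logNorm_le (E : HermitianModule.{u, v} K) (σ : K →+* ℂ) {z : Fiber σ E}
    {y : ℝ} (h : E.logNorm σ z ≤ (y : EReal)) : ‖z‖ ≤ Real.exp y :=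
  ENNReal.le_exp_of_log_ofReal_le h

end HermitianModule

end ArakelovCriterion

end
-- Choice of the constants
theorem mainTheorem6 (d : ℕ) (c₁ c₂ c₃ : ℝ) (hc₂ : 0 < c₂) :
    ∃ C₁ C₂ : ℝ, 0 < C₁ ∧
      ∀ (K : Type u) [Field K] [NumberField K], Module.finrank ℚ K = d →
      ∀ (σ₀ : K →+* ℂ) (H : ArakelovCriterion.HermitianModule.{u, u} K), H.rank = 1 →
      ∀ (m : ℕ) (E : ArakelovCriterion.HermitianModule.{u, v} K), E.rank = m →
      ∀ (f : ArakelovCriterion.Fiber σ₀ E), f ≠ 0 →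
      ∀ (b₁ b₂ : ℝ),
        (∀ᶠ x : ℕ in Filter.atTop, ∃ P : Fin m → E.dual.twist H x,
          LinearIndependent (NumberField.RingOfIntegers K) P ∧
          (∀ i, (⨆ σ : K →+* ℂ,
              (E.dual.twist H x).logNorm σ (ArakelovCriterion.Fiber.tmul σ 1 (P i))) ≤
            ((c₁ * x * Real.log x + b₁ * x : ℝ) : EReal)) ∧
          (∀ i, (H.pow x).logNorm σ₀ (E.pairing H x σ₀ (P i) f) ≤
            ((c₁ * x * Real.log x - c₂ * m * x * Real.log x + c₃ * x * Real.log x + b₂ * x : ℝ) :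
              EReal))) →
        C₁ * m + C₂ ≤ (Module.finrank K (E.minimalSubspace σ₀ f) : ℝ) := by
  have hM : 0 < (d + 1) * max c₁ 1 := by positivity
  -- The inequality to be divided is `c₂ m - c₃ ≤ d r c₁`. Replacing `c₁` by `max c₁ 1` and `d` by
  -- `d + 1` only enlarges the right side, and makes the divisor positive for every real `c₁` and
  -- every natural number `d`.
  refine ⟨c₂ / ((d + 1) * max c₁ 1), -c₃ / ((d + 1) * max c₁ 1), by positivity, ?_⟩
  rintro K _ _ rfl σ₀ H hH m E rfl f hf b₁ b₂ h
  have key := E.degree_inequality H hH σ₀ hf c₁ (c₁ - c₂ * E.rank + c₃) b₁ b₂ <| by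
    filter_upwards [h] with x ⟨P, hP, hP₁, hP₂⟩
    refine ⟨P, hP, fun i σ => ?_, fun i => ?_⟩
    · rw [← mul_assoc]
      exact ArakelovCriterion.HermitianModule.norm_le_exp_of_logNorm_le _ _
        ((le_iSup (fun σ : K →+* ℂ => (E.dual.twist H x).logNorm σ
          (ArakelovCriterion.Fiber.tmul σ 1 (P i))) σ).trans (hP₁ i))
    · have := ArakelovCriterion.HermitianModule.norm_le_exp_of_logNorm_le _ _ (hP₂ i)
      refine this.trans_eq (congrArg Real.exp ?_)
      ring
  rw [div_mul_eq_mul_div, ← add_div, div_le_iff₀ hM]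
  set r := Module.finrank K (E.minimalSubspace σ₀ f)
  have h₁ : (Module.finrank ℚ K * r : ℝ) * c₁ ≤ (Module.finrank ℚ K * r) * max c₁ 1 := by
    gcongr
    exact le_max_left _ _
  have h₂ : 0 ≤ r * max c₁ 1 := by positivity
  linarith
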